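/- Let \(L=\{+,-,\cdot,0,1,\le\}\) be the language of ordered rings. A discretely ordered ring is an ordered (commutative) ring with no element strictly between \(0\) and \(1\). An \(E_1\)-formula is an \(L\)-formula of the form \(\exists \bar y\le t(\bar x)\,\psi(\bar x,\bar y)\), where \(\psi\) is quantifier-free, \(t\) is an \(L\)-term, and the quantifier ranges over tuples \(\bar y=(y_1,\dots,y_k)\) with \(0\le y_i\le t(\bar x)\) for all \(i\). A model of \(IE_1\) (bounded existential induction) is a discretely ordered ring that satisfies, for every \(E_1\)-formula \(\varphi(\bar x,y)\), the axiom \[\forall\bar x\,\Bigl(\varphi(\bar x,0)\wedge\forall y\ge 0\,\bigl(\varphi(\bar x,y)\to\varphi(\bar x,y+1)\bigr)\to\forall y\ge 0\;\varphi(\bar x,y)\Bigr).\] A subring \(I\) of an ordered field \(F\) is an integer part of \(F\) if, with the order of \(F\), it is a discretely ordered ring and for every \(x\in F\) there is \(a\in I\) with \(a\le x<a+1\). Write \(\mathrm{Frac}(I)\subseteq F\) for the fraction field of \(I\). **Theorem (Dirichlet's Approximation Lemma in \(IE_1\)).** Let \(F\) be an ordered field and let \(I\) be an integer part of \(F\)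 that is a model of \(IE_1\). For every \(\alpha\in F\setminus\mathrm{Frac}(I)\) and every \(Q\in I\) with \(Q>0\) there exist \(p,q\in I\) such that \(1\le q\le Q\), \(p\) and \(q\) are coprime (that is, \(up+vq=1\) for some \(u,v\in I\)), and \[\Bigl|\frac pq-\alpha\Bigr|\le\frac1{qQ}.\] -/

import Mathlib

open FirstOrder FirstOrder.Language

/-- The language `{+, -, ·, 0, 1, ≤}` of ordered rings: Mathlib's language of rings together with
Mathlib's language of orders. -/
def ordRingLang : FirstOrder.Language :=
  Language.ring.sum Language.order

namespace OrdRing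

instance : ordRingLang.IsOrdered :=
  inferInstanceAs ((Language.ring.sum Language.order).IsOrdered)

/-- An ordered ring, as a structure in the language of ordered rings: the symbols are interpreted by
the ring operations and the order relation. -/
instance ordRingStructure (R : Type*) [CommRing R] [LinearOrder R] : ordRingLang.Structure R :=
  letI := (Ring.compatibleRingOfRing R).toStructure
  letI := Language.orderStructure R
  inferInstanceAs ((Language.ring.sum Language.order).Structure R)

instance (R : Type*) [CommRing R] [LinearOrder R] : ordRingLang.OrderedStructure R :=
  ⟨fun _ => Iff.rfl⟩

/-- The constant symbol `0`, as a term. -/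
def zeroTerm {α : Type*} : ordRingLang.Term α :=
  Constants.term (Sum.inl Ring.zeroFunc : ordRingLang.Constants)

theorem realize_zeroTerm {R : Type*} [CommRing R] [LinearOrder R] {α : Type*} (v : α → R) :
    (zeroTerm : ordRingLang.Term α).realize v = 0 :=
  rfl

/-- The formula `∃ y₁ … y_k, (⋀ i, 0 ≤ y_i ∧ y_i ≤ t(x)) ∧ ψ(x, y₁, …, y_k)`, where the variables
`x` are indexed by `α`: the bounded existential quantification `∃ ȳ ≤ t(x), ψ(x, ȳ)`. -/
noncomputable def boundedEx {α : Type*} {k : ℕ} (t : ordRingLang.Term α)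
    (ψ : ordRingLang.BoundedFormula α k) : ordRingLang.Formula α :=
  ((BoundedFormula.iInf fun i : Fin k =>
      (zeroTerm.le (Term.var (Sum.inr i))) ⊓
        ((Term.var (Sum.inr i)).le (t.relabel Sum.inl))) ⊓ ψ).exs

theorem realize_boundedEx {R : Type*} [CommRing R] [LinearOrder R] {α : Type*} {k : ℕ}
    (t : ordRingLang.Term α) (ψ : ordRingLang.BoundedFormula α k) (v : α → R) :
    (boundedEx t ψ).Realize v ↔
      ∃ y : Fin k → R, (∀ i, 0 ≤ y i ∧ y i ≤ t.realize v) ∧ ψ.Realize v y := by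
  simp [boundedEx, BoundedFormula.realize_exs, realize_zeroTerm, Function.comp_def]

/-- `E₁`-formulas: bounded existential quantifications `∃ ȳ ≤ t(x), ψ(x, ȳ)` of open (that is,
quantifier-free) formulas `ψ`, with `t` a term in which no `y_i` occurs. -/
def IsE1 {α : Type*} (φ : ordRingLang.Formula α) : Prop :=
  ∃ (k : ℕ) (t : ordRingLang.Term α) (ψ : ordRingLang.BoundedFormula α k),
    ψ.IsQF ∧ φ = boundedEx t ψ

/-- A discretely ordered ring: an ordered ring with no element strictly between `0` and `1`. -/
def IsDOR (R : Type*) [CommRing R] [LinearOrder R] [IsStrictOrderedRing R] : Prop :=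
  ∀ x : R, ¬ (0 < x ∧ x < 1)

/-- Models of `IE₁`: discretely ordered rings that satisfy, for all `E₁`-formulas `φ(y, x)` and all
parameters `x = (x₁, …, xₙ)`, the induction axiom for `φ` in the variable `y` over the nonnegative
elements. -/
structure ModelsIE1 (R : Type*) [CommRing R] [LinearOrder R] [IsStrictOrderedRing R] : Prop where
  discrete : IsDOR R
  induction : ∀ (n : ℕ) (φ : ordRingLang.Formula (Fin (n + 1))), IsE1 φ → ∀ x : Fin n → R,
    φ.Realize (Fin.cons 0 x : Fin (n + 1) → R) →
    (∀ y : R, 0 ≤ y → φ.Realize (Fin.cons y x : Fin (n + 1) → R) →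
      φ.Realize (Fin.cons (y + 1) x : Fin (n + 1) → R)) →
    ∀ y : R, 0 ≤ y → φ.Realize (Fin.cons y x : Fin (n + 1) → R)

/-- The subring `I` is an integer part of the ordered field `F`: it is discretely ordered (by the
order of `F`), and every `x` in `F` satisfies `a ≤ x < a + 1` for some `a` in `I`. -/
structure IsIntegerPart {F : Type*} [Field F] [LinearOrder F] [IsStrictOrderedRing F]
    (I : Subring F) : Prop where
  discrete : IsDOR I
  exists_floor : ∀ x : F, ∃ a : I, (a : F) ≤ x ∧ x < (a : F) + 1

/-- The fraction field of the subring `I`, as a subfield of `F`. -/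
def fracField {F : Type*} [Field F] (I : Subring F) : Subfield F :=
  Subfield.closure (I : Set F)

theorem mem_fracField {F : Type*} [Field F] (I : Subring F) (x : F) :
    x ∈ fracField I ↔ ∃ a b : I, b ≠ 0 ∧ x = (a : F) / (b : F) := by
  rw [fracField, Subfield.mem_closure_iff, Subring.closure_eq]
  constructor
  · rintro ⟨a, ha, b, hb, rfl⟩
    by_cases h : b = 0
    · exact ⟨0, 1, fun h1 => one_ne_zero (congrArg (Subtype.val : I → F) h1), by simp [h]⟩
    · exact ⟨⟨a, ha⟩, ⟨b, hb⟩, fun h1 => h (congrArg (Subtype.val : I → F) h1), rfl⟩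
  · rintro ⟨a, b, -, rfl⟩
    exact ⟨a, a.2, b, b.2, rfl⟩

end OrdRing

/-!
Suppose first that `0 ≤ α < 1`, and let `A / N` with `N = Q²` and `A = ⌊α N⌋` replace the
element `α`, which the language cannot name. The theorem rests on neighbours
`p / q ≤ A / N < p' / q'` of the Farey sequence of order `Q`, that is, `p' q - p q' = 1`,
`q, q' ≤ Q` and `Q < q + q'`.
The pigeonhole principle is not needed for them: the existence of such a pair of fractions with
`q + q' ≥ min y (Q + 1)` is an `E₁`-property of `y`, and as long as `q + q' ≤ Q`, the
mediant `(p + p') / (q + q')` can replace one of the two fractions, which increases the sum of the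
denominators (`OrdRing.ModelsIE1.exists_farey_neighbours`).

One of the two neighbours is the required fraction (`OrdRing.farey_approx`). If `α ≤ p' / q'`, then
`α` lies between them, and the one on the same side of the mediant as `α` is at distance at most
`1 / (q (q + q'))` or `1 / (q' (q + q'))`. Otherwise `p' / q'` lies between `A / N` and
`α < (A + 1) / N`, hence at distance at most `1 / Q²` from `α`. Coprimality is the determinant
identity `p' q - p q' = 1`. A general `α` is reduced to this case by subtracting its integer part.
-/

namespace OrdRing

/-! ### Terms of the language of ordered rings -/

/-- The constant symbol `1`, as a term. -/
def oneTerm {α : Type*} : ordRingLang.Term α :=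
  Constants.term (Sum.inl Ring.oneFunc : ordRingLang.Constants)

/-- The sum of two terms. -/
def addTerm {α : Type*} (s t : ordRingLang.Term α) : ordRingLang.Term α :=
  Functions.apply₂ (Sum.inl Ring.addFunc : ordRingLang.Functions 2) s t

/-- The product of two terms. -/
def mulTerm {α : Type*} (s t : ordRingLang.Term α) : ordRingLang.Term α :=
  Functions.apply₂ (Sum.inl Ring.mulFunc : ordRingLang.Functions 2) s t

section Realize

variable {R : Type*} [CommRing R] [LinearOrder R] {α : Type*} (v : α → R)

theorem realize_oneTerm : (oneTerm : ordRingLang.Term α).realize v = 1 :=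
  rfl

theorem realize_addTerm (s t : ordRingLang.Term α) :
    (addTerm s t).realize v = s.realize v + t.realize v :=
  rfl

theorem realize_mulTerm (s t : ordRingLang.Term α) :
    (mulTerm s t).realize v = s.realize v * t.realize v :=
  rfl

end Realize

/-! ### Farey neighbours in models of bounded existential induction -/

theorem IsDOR.add_one_le {R : Type*} [CommRing R] [LinearOrder R] [IsStrictOrderedRing R]
    (h : IsDOR R) {a b : R} (hab : a < b) : a + 1 ≤ b := by
  by_contra! hlt
  exact h (b - a) ⟨by linarith, by linarith⟩

/-- The quantifier-free formula saying of `(y, A, N, Q)` and `(p, q, p', q')` that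
`p / q ≤ A / N < p' / q'` are fractions in `[0, 1]` of determinant `p' q - p q' = 1` with
`min y (Q + 1) ≤ q + q'`. The bounds `0 ≤ p, q, p', q' ≤ Q` are left to the quantifier. -/
def fareyQF : ordRingLang.BoundedFormula (Fin 4) 4 :=
  let y : ordRingLang.Term (Fin 4 ⊕ Fin 4) := Term.var (Sum.inl 0)
  let A : ordRingLang.Term (Fin 4 ⊕ Fin 4) := Term.var (Sum.inl 1)
  let N : ordRingLang.Term (Fin 4 ⊕ Fin 4) := Term.var (Sum.inl 2)
  let Q : ordRingLang.Term (Fin 4 ⊕ Fin 4) := Term.var (Sum.inl 3)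
  let p : ordRingLang.Term (Fin 4 ⊕ Fin 4) := Term.var (Sum.inr 0)
  let q : ordRingLang.Term (Fin 4 ⊕ Fin 4) := Term.var (Sum.inr 1)
  let p' : ordRingLang.Term (Fin 4 ⊕ Fin 4) := Term.var (Sum.inr 2)
  let q' : ordRingLang.Term (Fin 4 ⊕ Fin 4) := Term.var (Sum.inr 3)
  oneTerm.le q ⊓ (oneTerm.le q' ⊓ (p.le q ⊓ (p'.le q' ⊓
    (((mulTerm p' q).bdEqual (addTerm (mulTerm p q') oneTerm)) ⊓
      ((mulTerm p N).le (mulTerm A q) ⊓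
        ((addTerm (mulTerm A q') oneTerm).le (mulTerm p' N) ⊓
          (y.le (addTerm q q') ⊔ (addTerm Q oneTerm).le (addTerm q q'))))))))

theorem isQF_fareyQF : fareyQF.IsQF := by
  have hle (s t : ordRingLang.Term (Fin 4 ⊕ Fin 4)) : (s.le t).IsQF :=
    (BoundedFormula.IsAtomic.rel _ _).isQF
  have heq (s t : ordRingLang.Term (Fin 4 ⊕ Fin 4)) : (s.bdEqual t).IsQF :=
    (BoundedFormula.IsAtomic.equal _ _).isQF
  exact (hle _ _).inf <| (hle _ _).inf <| (hle _ _).inf <| (hle _ _).inf <| (heq _ _).inf <|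
    (hle _ _).inf <| (hle _ _).inf <| (hle _ _).sup (hle _ _)

/-- The `E₁`-formula in `(y, A, N, Q)` obtained from `fareyQF` by quantifying `(p, q, p', q')`
up to `Q`. -/
noncomputable def fareyFormula : ordRingLang.Formula (Fin 4) :=
  boundedEx (Term.var 3) fareyQF

theorem realize_fareyFormula {R : Type*} [CommRing R] [LinearOrder R] (y A N Q : R) :
    fareyFormula.Realize (Fin.cons y ![A, N, Q] : Fin 4 → R) ↔
      ∃ p q p' q' : R, (0 ≤ p ∧ p ≤ q) ∧ (1 ≤ q ∧ q ≤ Q) ∧ (0 ≤ p' ∧ p' ≤ q') ∧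
        (1 ≤ q' ∧ q' ≤ Q) ∧ 0 ≤ q ∧ 0 ≤ q' ∧ p ≤ Q ∧ p' ≤ Q ∧
        p' * q = p * q' + 1 ∧ p * N ≤ A * q ∧ A * q' + 1 ≤ p' * N ∧
        (y ≤ q + q' ∨ Q + 1 ≤ q + q') := by
  have hv (z : Fin 4 → R) : fareyQF.Realize (Fin.cons y ![A, N, Q] : Fin 4 → R) z ↔
      1 ≤ z 1 ∧ 1 ≤ z 3 ∧ z 0 ≤ z 1 ∧ z 2 ≤ z 3 ∧ z 2 * z 1 = z 0 * z 3 + 1 ∧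
        z 0 * N ≤ A * z 1 ∧ A * z 3 + 1 ≤ z 2 * N ∧ (y ≤ z 1 + z 3 ∨ Q + 1 ≤ z 1 + z 3) := by
    simp only [fareyQF, BoundedFormula.realize_inf, BoundedFormula.realize_sup, Term.realize_le,
      BoundedFormula.realize_bdEqual, realize_addTerm, realize_mulTerm, realize_oneTerm,
      Term.realize_var, Sum.elim_inl, Sum.elim_inr]
    rfl
  have hQ : (Term.var 3 : ordRingLang.Term (Fin 4)).realize
      (Fin.cons y ![A, N, Q] : Fin 4 → R) = Q := rfl
  rw [fareyFormula, realize_boundedEx]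
  simp only [hv, hQ]
  constructor
  · rintro ⟨z, hz, h⟩
    have h0 := hz 0
    have h1 := hz 1
    have h2 := hz 2
    have h3 := hz 3
    exact ⟨z 0, z 1, z 2, z 3, by tauto⟩
  · rintro ⟨p, q, p', q', h⟩
    refine ⟨![p, q, p', q'], ?_, ?_⟩
    · simp only [Fin.forall_fin_succ, IsEmpty.forall_iff, and_true]
      change (0 ≤ p ∧ p ≤ Q) ∧ (0 ≤ q ∧ q ≤ Q) ∧ (0 ≤ p' ∧ p' ≤ Q) ∧ 0 ≤ q' ∧ q' ≤ Q
      tauto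
    · change 1 ≤ q ∧ 1 ≤ q' ∧ p ≤ q ∧ p' ≤ q' ∧ p' * q = p * q' + 1 ∧
        p * N ≤ A * q ∧ A * q' + 1 ≤ p' * N ∧ (y ≤ q + q' ∨ Q + 1 ≤ q + q')
      tauto

/-- For `0 ≤ A / N < 1`, the Farey sequence of order `Q` has neighbours
`p / q ≤ A / N < p' / q'`. -/
theorem ModelsIE1.exists_farey_neighbours {R : Type*} [CommRing R] [LinearOrder R]
    [IsStrictOrderedRing R] (hR : ModelsIE1 R) {A N Q : R} (hA : 0 ≤ A) (hAN : A < N)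
    (hQ : 0 < Q) :
    ∃ p q p' q' : R, (1 ≤ q ∧ q ≤ Q) ∧ (1 ≤ q' ∧ q' ≤ Q) ∧ p' * q = p * q' + 1 ∧
      p * N ≤ A * q ∧ A * q' < p' * N ∧ Q < q + q' := by
  have hQ1 : 1 ≤ Q := by simpa using hR.discrete.add_one_le hQ
  have hAN1 := hR.discrete.add_one_le hAN
  have key : fareyFormula.Realize (Fin.cons (Q + 1) ![A, N, Q] : Fin 4 → R) := by
    refine hR.induction 3 fareyFormula ⟨4, _, _, isQF_fareyQF, rfl⟩ ![A, N, Q] ?_ ?_ (Q + 1)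
      (by linarith)
    · rw [realize_fareyFormula]
      -- The neighbours `0 / 1` and `1 / 1` of order `1`.
      refine ⟨0, 1, 1, 1, ?_⟩
      simp [hA, hAN1, hQ1, hQ.le]
    · intro y _
      rw [realize_fareyFormula, realize_fareyFormula]
      rintro ⟨p, q, p', q', ⟨hp, hpq⟩, ⟨hq, hqQ⟩, ⟨hp', hpq'⟩, ⟨hq', hqQ'⟩, hq0, hq0', hpQ, hpQ',
        hdet, hl, hr, hy⟩
      by_cases hs : Q + 1 ≤ q + q'
      · exact ⟨p, q, p', q', ⟨hp, hpq⟩, ⟨hq, hqQ⟩, ⟨hp', hpq'⟩, ⟨hq', hqQ'⟩, hq0, hq0', hpQ, hpQ',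
          hdet, hl, hr, Or.inr hs⟩
      have hy' : y ≤ q + q' := hy.resolve_right hs
      have hsQ : q + q' ≤ Q := by
        by_contra! h
        exact hs (hR.discrete.add_one_le h)
      rcases le_or_gt ((p + p') * N) (A * (q + q')) with hm | hm
      · exact ⟨p + p', q + q', p', q', ⟨by linarith, by linarith⟩, ⟨by linarith, hsQ⟩, ⟨hp', hpq'⟩,
          ⟨hq', hqQ'⟩, by linarith, hq0', by linarith, hpQ', by linear_combination hdet, hm, hr,
          Or.inl (by linarith)⟩
      · exact ⟨p, q, p + p', q + q', ⟨hp, hpq⟩, ⟨hq, hqQ⟩, ⟨by linarith, by linarith⟩,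
          ⟨by linarith, hsQ⟩, hq0, by linarith, hpQ, by linarith, by linear_combination hdet, hl,
          hR.discrete.add_one_le hm, Or.inl (by linarith)⟩
  rw [realize_fareyFormula] at key
  obtain ⟨p, q, p', q', -, hq, -, hq', -, -, -, -, hdet, hl, hr, hs⟩ := key
  exact ⟨p, q, p', q', hq, hq', hdet, hl, by linarith, by rcases hs with h | h <;> linarith⟩

/-! ### Approximation by Farey neighbours -/

/-- If `p / q ≤ β` and `p' / q'` are Farey neighbours of order `Q`, and `β` exceeds `p' / q'` by at
most `1 / Q²`, then one of them approximates `β` as in Dirichlet's lemma. -/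
theorem farey_approx {F : Type*} [Field F] [LinearOrder F] [IsStrictOrderedRing F]
    {p q p' q' Q β : F} (hq : 0 < q) (hq' : 0 < q') (hqQ' : q' ≤ Q)
    (hdet : p' * q = p * q' + 1) (hs : Q ≤ q + q') (hl : p / q ≤ β)
    (hr : β ≤ p' / q' + 1 / (Q * Q)) :
    |p / q - β| ≤ 1 / (q * Q) ∨ |p' / q' - β| ≤ 1 / (q' * Q) := by
  have hQ : 0 < Q := hq'.trans_le hqQ'
  have hsum : 0 < q + q' := by linarith
  rcases le_total (p' / q') β with h | h
  · right
    rw [abs_sub_comm, abs_of_nonneg (by linarith)]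
    have : 1 / (Q * Q) ≤ 1 / (q' * Q) := by gcongr
    linarith
  rcases le_total β ((p + p') / (q + q')) with hm | hm
  · left
    rw [abs_sub_comm, abs_of_nonneg (by linarith)]
    have e : (p + p') / (q + q') - p / q = 1 / (q * (q + q')) := by
      field_simp
      linear_combination hdet
    have : 1 / (q * (q + q')) ≤ 1 / (q * Q) := by gcongr
    linarith
  · right
    rw [abs_of_nonneg (by linarith)]
    have e : p' / q' - (p + p') / (q + q') = 1 / (q' * (q + q')) := by
      field_simp
      linear_combination hdet
    have : 1 / (q' * (q + q')) ≤ 1 / (q' * Q) := by gcongr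
    linarith

end OrdRing

theorem theorem4p6 {F : Type*} [Field F] [LinearOrder F] [IsStrictOrderedRing F]
    (I : Subring F) (hI : OrdRing.IsIntegerPart I) (hIE1 : OrdRing.ModelsIE1 I)
    (α : F) (hα : α ∉ OrdRing.fracField I) (Q : I) (hQ : 0 < Q) :
    ∃ p q : I, 1 ≤ q ∧ q ≤ Q ∧ IsCoprime p q ∧
      |(p : F) / (q : F) - α| ≤ 1 / ((q : F) * (Q : F)) := by
  obtain ⟨c, hc, hc'⟩ := hI.exists_floor α
  have hQF : (0 : F) < Q := by exact_mod_cast hQ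
  have hQQ : (0 : F) < Q * Q := by positivity
  obtain ⟨A, hA, hA'⟩ := hI.exists_floor ((α - c) * (Q * Q))
  have hA0 : 0 ≤ A := by
    have h1 : 0 ≤ (α - c) * (Q * Q) := mul_nonneg (by linarith) hQQ.le
    have h2 : (0 : F) < A + 1 := by linarith
    have h3 : 0 < A + 1 := by exact_mod_cast h2
    simpa using hI.discrete.add_one_le h3
  have hAN : A < Q * Q := by
    have h1 : (α - c) * (Q * Q) < 1 * (Q * Q) := mul_lt_mul_of_pos_right (by linarith) hQQ
    have h2 : (A : F) < Q * Q := by linarith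
    exact_mod_cast h2
  obtain ⟨p, q, p', q', ⟨hq, hqQ⟩, ⟨hq', hqQ'⟩, hdet, hl, hr, hs⟩ :=
    hIE1.exists_farey_neighbours hA0 hAN hQ
  have hqF : (0 : F) < q := by exact_mod_cast zero_lt_one.trans_le hq
  have hqF' : (0 : F) < q' := by exact_mod_cast zero_lt_one.trans_le hq'
  have hAl : (A : F) / (Q * Q) ≤ α - c := (div_le_iff₀ hQQ).2 hA
  have hAr : α - c ≤ (A : F) / (Q * Q) + 1 / (Q * Q) := by
    rw [← add_div]
    exact (le_div_iff₀ hQQ).2 hA'.le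
  have hlF : (p : F) / q ≤ A / (Q * Q) := by
    rw [div_le_div_iff₀ hqF hQQ]
    exact_mod_cast hl
  have hrF : (A : F) / (Q * Q) ≤ p' / q' := by
    rw [div_le_div_iff₀ hQQ hqF']
    exact_mod_cast hr.le
  -- Adding `c` to the fraction `a / b` turns an approximation of `α - c` into one of `α`.
  have shift (a b : I) (hb : (0 : F) < b) :
      (((a + c * b : I) : F) / b - α) = a / b - (α - c) := by
    push_cast
    field_simp
    ring
  rcases OrdRing.farey_approx (p := (p : F)) (p' := (p' : F)) (Q := (Q : F)) hqF hqF'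
    (by exact_mod_cast hqQ') (by exact_mod_cast hdet) (by exact_mod_cast hs.le) (hlF.trans hAl) (hAr.trans (by linarith)) with h | h
  · refine ⟨p + c * q, q, hq, hqQ, IsCoprime.add_mul_right_left ?_ c, by rwa [shift p q hqF]⟩
    exact ⟨-q', p', by linear_combination hdet⟩
  · refine ⟨p' + c * q', q', hq', hqQ', IsCoprime.add_mul_right_left ?_ c,
      by rwa [shift p' q' hqF']⟩
    exact ⟨q, -p, by linear_combination hdet⟩
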